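/- Let $\mathbb{K}$ be $\mathbb{R}$ or $\mathbb{C}$. A Banach space $W$ over $\mathbb{K}$ has the \emph{alternate lifting property} (ALP) if for all Banach spaces $X$ and $Y$ over $\mathbb{K}$, every bounded linear operator $\psi$ from $X$ onto $W$ and every bounded linear operator $S\colon Y\to W$, there is a bounded linear operator $\hat S\colon Y\to X$ with $S=\psi\circ\hat S$. \textbf{Theorem.} A Banach space $W$ over $\mathbb{K}$ has the ALP if and only if there is a (possibly empty) index set $\Gamma$ such that $W$ is linearly homeomorphic to $\ell_1(\Gamma)$, the Banach space of absolutely summable families $(a_\gamma)_{\gamma\in\Gamma}$ in $\mathbb{K}$ with norm $\sum_{\gamma\in\Gamma}|a_\gamma|$. -/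

import Mathlib

universe u

/-- The alternate lifting property of a Banach space `W` over `𝕜`: for all Banach spaces `X`, `Y`
over `𝕜`, every bounded linear operator `S : Y → W` lifts through every bounded linear operator `ψ`
from `X` onto `W`. -/
def HasALP (𝕜 : Type) [RCLike 𝕜] (W : Type u) [NormedAddCommGroup W] [NormedSpace 𝕜 W] : Prop :=
  ∀ (X Y : Type u) [NormedAddCommGroup X] [NormedSpace 𝕜 X] [CompleteSpace X]
    [NormedAddCommGroup Y] [NormedSpace 𝕜 Y] [CompleteSpace Y]
    (ψ : X →L[𝕜] W) (_ : Function.Surjective ψ) (S : Y →L[𝕜] W),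
    ∃ T : Y →L[𝕜] X, S = ψ.comp T

/-!
A bounded family in a Banach space extends from the unit vectors to an operator on `ℓ₁(Γ)`
(`LOne.lift`). With the open mapping theorem this gives the lifting property of `ℓ₁(Γ)`.

Conversely, let `W` have the lifting property. Lifting the identity of `W` through a surjection
`ℓ₁(D) → W`, which exists for every net `D` of the unit ball (`LOne.lift_surjective`), makes `W` a
complemented subspace of `ℓ₁(D)`. It remains to see that `W` is then itself an `ℓ₁`-space, of an
arbitrary density. Embed `W` in some `ℓ₁(Γ)` and take a maximal disjoint family `𝓔` of finite subsets
of `Γ` for each of which some vector of `W` has at least twice as much mass inside the set as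
outside (`LOne.exists_maximal_concentrated`).

* These vectors span a complemented copy of `ℓ₁(𝓔)` in `W`
  (`LOne.exists_leftInverse_of_concentrated`).
* By maximality, restriction of `W` to the coordinates in `⋃ 𝓔` is bounded below. If `𝓔` is finite,
  `W` is finite-dimensional. Otherwise the unit ball of `W` has a net of cardinality at most `#𝓔`,
  and so `W` is complemented in `ℓ₁(𝓔)`.

Thus each of `W` and `ℓ₁(𝓔)` is complemented in the other. If `W ≃ ℓ₁(𝓔) × Z`, then `Z` is
complemented in `ℓ₁(𝓔)`, and an infinite-dimensional `ℓ₁`-space absorbs its complemented subspaces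
by a swindle (`LOne.nonempty_prod_equiv_of_complemented`), so that `W ≃ ℓ₁(𝓔)`.
-/

open Function Set

/-! ### The universal property of `ℓ₁` -/

/-- The space `ℓ₁(Γ)` of absolutely summable families of scalars. -/
abbrev LOne (𝕜 : Type*) [RCLike 𝕜] (Γ : Type*) := lp (fun _ : Γ => 𝕜) 1

namespace LOne

variable {𝕜 : Type*} [RCLike 𝕜] {Γ Γ' I : Type*}
variable {W : Type*} [NormedAddCommGroup W] [NormedSpace 𝕜 W]

open scoped Classical in
/-- The unit vector of `ℓ₁(Γ)` at `γ`. -/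
noncomputable def unitVec (𝕜 : Type*) [RCLike 𝕜] (γ : Γ) : LOne 𝕜 Γ := lp.single 1 γ (1 : 𝕜)

open scoped Classical in
theorem unitVec_apply (γ γ' : Γ) : unitVec 𝕜 γ γ' = if γ' = γ then 1 else 0 := by
  simp [unitVec, Pi.single_apply]

@[simp]
theorem norm_unitVec (γ : Γ) : ‖unitVec 𝕜 γ‖ = 1 := by
  simp [unitVec]

theorem hasSum_unitVec (x : LOne 𝕜 Γ) : HasSum (fun γ => x γ • unitVec 𝕜 γ) x := by
  classical
  have h := lp.hasSum_single (E := fun _ : Γ => 𝕜) (p := 1) (by simp) x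
  convert h using 2 with γ
  rw [unitVec, ← lp.single_smul]
  simp

theorem hasSum_norm (x : LOne 𝕜 Γ) : HasSum (fun γ => ‖x γ‖) ‖x‖ := by
  simpa using lp.hasSum_norm (E := fun _ : Γ => 𝕜) (p := 1) (by simp) x

theorem ext_unitVec {T T' : LOne 𝕜 Γ →L[𝕜] W}
    (h : ∀ γ, T (unitVec 𝕜 γ) = T' (unitVec 𝕜 γ)) : T = T' := by
  ext x
  have h1 := (hasSum_unitVec x).mapL T
  have h2 := (hasSum_unitVec x).mapL T'
  simp only [map_smul, h] at h1 h2
  exact h1.unique h2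

section Lift

variable [CompleteSpace W]

/-- The operator on `ℓ₁(Γ)` that sends the unit vectors to the members of a given bounded family
in a Banach space. -/
noncomputable def lift (t : Γ → W) (C : ℝ) (ht : ∀ γ, ‖t γ‖ ≤ C) : LOne 𝕜 Γ →L[𝕜] W :=
  have hb (x : LOne 𝕜 Γ) (γ : Γ) : ‖x γ • t γ‖ ≤ C * ‖x γ‖ := by
    rw [norm_smul, mul_comm]
    exact mul_le_mul_of_nonneg_right (ht γ) (norm_nonneg _)
  have hs (x : LOne 𝕜 Γ) : Summable fun γ => x γ • t γ :=
    .of_norm_bounded ((hasSum_norm x).summable.mul_left C) (hb x)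
  LinearMap.mkContinuous
    { toFun := fun x => ∑' γ, x γ • t γ
      map_add' := fun x y => by
        rw [← (hs x).tsum_add (hs y)]
        simp [add_smul]
      map_smul' := fun c x => by
        rw [RingHom.id_apply, ← (hs x).tsum_const_smul c]
        simp [mul_smul] }
    C fun x => tsum_of_norm_bounded ((hasSum_norm x).mul_left C) (hb x)

@[simp]
theorem lift_unitVec (t : Γ → W) (C : ℝ) (ht : ∀ γ, ‖t γ‖ ≤ C) (γ : Γ) :
    lift (𝕜 := 𝕜) t C ht (unitVec 𝕜 γ) = t γ := by
  change ∑' γ', unitVec 𝕜 γ γ' • t γ' = t γ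
  rw [tsum_eq_single γ fun γ' h => by simp [unitVec_apply, h]]
  simp [unitVec_apply]

theorem norm_lift_apply_le (t : Γ → W) {C : ℝ} (ht : ∀ γ, ‖t γ‖ ≤ C) (x : LOne 𝕜 Γ) :
    ‖lift (𝕜 := 𝕜) t C ht x‖ ≤ C * ‖x‖ :=
  tsum_of_norm_bounded ((hasSum_norm x).mul_left C) fun γ => by
    rw [norm_smul, mul_comm]
    exact mul_le_mul_of_nonneg_right (ht γ) (norm_nonneg _)

end Lift

/-- The operator `ℓ₁(Γ) → ℓ₁(Γ')` that maps unit vectors to unit vectors or to zero, as prescribed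
by a partial function `g` from `Γ` to `Γ'`. -/
noncomputable def partialMap (g : Γ → Option Γ') : LOne 𝕜 Γ →L[𝕜] LOne 𝕜 Γ' :=
  lift (fun γ => (g γ).elim 0 (unitVec 𝕜)) 1 fun γ => by cases g γ <;> simp

@[simp]
theorem partialMap_unitVec (g : Γ → Option Γ') (γ : Γ) :
    partialMap g (unitVec 𝕜 γ) = (g γ).elim 0 (unitVec 𝕜) := by
  simp [partialMap]

theorem norm_partialMap_apply_le (g : Γ → Option Γ') (x : LOne 𝕜 Γ) :
    ‖partialMap g x‖ ≤ ‖x‖ :=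
  (norm_lift_apply_le _ _ x).trans_eq (one_mul _)

/-- A bijection of index sets induces an isomorphism of `ℓ₁`-spaces. -/
noncomputable def reindex (e : Γ ≃ Γ') : LOne 𝕜 Γ ≃L[𝕜] LOne 𝕜 Γ' :=
  .equivOfInverse (partialMap fun γ => some (e γ)) (partialMap fun γ => some (e.symm γ))
    (DFunLike.congr_fun (f := (partialMap fun γ => some (e.symm γ)) ∘L
      (partialMap fun γ => some (e γ))) (g := .id 𝕜 (LOne 𝕜 Γ)) (ext_unitVec fun γ => by simp))
    (DFunLike.congr_fun (f := (partialMap fun γ => some (e γ)) ∘L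
      (partialMap fun γ => some (e.symm γ))) (g := .id 𝕜 (LOne 𝕜 Γ')) (ext_unitVec fun γ => by simp))

/-- An injection of index sets makes `ℓ₁(Γ)` a complemented subspace of `ℓ₁(Γ')`. -/
theorem exists_leftInverse_of_embedding (f : Γ ↪ Γ') :
    ∃ (i : LOne 𝕜 Γ →L[𝕜] LOne 𝕜 Γ') (r : LOne 𝕜 Γ' →L[𝕜] LOne 𝕜 Γ), r ∘L i = .id 𝕜 _ := by
  refine ⟨partialMap fun γ => some (f γ), partialMap (partialInv f), ext_unitVec fun γ => ?_⟩
  simp [partialInv_left f.injective]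

/-- On a finite index set every family is absolutely summable. -/
noncomputable def equivFun (𝕜 : Type*) [RCLike 𝕜] (Γ : Type*) [Fintype Γ] :
    LOne 𝕜 Γ ≃ₗ[𝕜] (Γ → 𝕜) :=
  (lpPiLpₗᵢ (fun _ : Γ => 𝕜) 𝕜 (p := 1)).toLinearEquiv.trans (WithLp.linearEquiv 1 𝕜 (Γ → 𝕜))

/-! ### Restriction to a set of coordinates -/

open scoped Classical in
/-- The projection of `ℓ₁(Γ)` that keeps the coordinates in `A` and annihilates the others. -/
noncomputable def restr (A : Set Γ) : LOne 𝕜 Γ →L[𝕜] LOne 𝕜 Γ :=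
  partialMap fun γ => if γ ∈ A then some γ else none

open scoped Classical in
theorem restr_unitVec (A : Set Γ) (γ : Γ) :
    restr A (unitVec 𝕜 γ) = if γ ∈ A then unitVec 𝕜 γ else 0 := by
  by_cases h : γ ∈ A <;> simp [restr, h]

theorem norm_restr_apply_le (A : Set Γ) (x : LOne 𝕜 Γ) : ‖restr A x‖ ≤ ‖x‖ :=
  norm_partialMap_apply_le _ x

theorem restr_diff (A B : Set Γ) (x : LOne 𝕜 Γ) :
    restr (A \ B) x = restr A x - restr A (restr B x) := by
  have h : restr (A \ B) = restr (𝕜 := 𝕜) A - restr A ∘L restr B := ext_unitVec fun γ => by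
    by_cases hA : γ ∈ A <;> by_cases hB : γ ∈ B <;> simp [restr_unitVec, hA, hB]
  exact DFunLike.congr_fun h x

theorem restr_finset (E : Finset Γ) (x : LOne 𝕜 Γ) :
    restr (E : Set Γ) x = ∑ γ ∈ E, x γ • unitVec 𝕜 γ := by
  have h := (hasSum_unitVec x).mapL (restr (E : Set Γ))
  refine h.unique ?_
  have h2 := hasSum_sum_of_ne_finset_zero (L := .unconditional Γ)
    (f := fun γ => restr (E : Set Γ) (x γ • unitVec 𝕜 γ)) (s := E)
    fun γ hγ => by simp [restr_unitVec, hγ]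
  rwa [Finset.sum_congr rfl fun γ hγ => by
    rw [map_smul, restr_unitVec, if_pos (Finset.mem_coe.2 hγ)]] at h2

theorem exists_norm_sub_restr_lt (x : LOne 𝕜 Γ) {ε : ℝ} (hε : 0 < ε) :
    ∃ E : Finset Γ, ‖x - restr (E : Set Γ) x‖ < ε := by
  obtain ⟨E, hE⟩ := ((Metric.tendsto_nhds.1 (hasSum_unitVec x)) ε hε).exists
  exact ⟨E, by rwa [dist_comm, dist_eq_norm, ← restr_finset] at hE⟩

open scoped Classical in
/-- The operator `ℓ₁(Γ) → ℓ₁(A)` that forgets the coordinates outside `A`. -/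
noncomputable def toSubtype (A : Set Γ) : LOne 𝕜 Γ →L[𝕜] LOne 𝕜 A :=
  partialMap fun γ => if h : γ ∈ A then some ⟨γ, h⟩ else none

theorem norm_restr_apply_le_norm_toSubtype (A : Set Γ) (x : LOne 𝕜 Γ) :
    ‖restr A x‖ ≤ ‖toSubtype A x‖ := by
  have h : restr A = (partialMap fun γ : A => some γ.1) ∘L toSubtype (𝕜 := 𝕜) A :=
    ext_unitVec fun γ => by by_cases h : γ ∈ A <;> simp [restr_unitVec, toSubtype, h]
  rw [h]
  exact norm_partialMap_apply_le _ _

/-! ### Surjections from `ℓ₁`-spaces -/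

/-- A linear operator that reaches every vector up to half its norm, with control of the preimage,
is onto: the errors can be corrected successively. -/
theorem surjective_of_approx {V : Type*} [NormedAddCommGroup V] [NormedSpace 𝕜 V] [CompleteSpace V]
    (T : V →L[𝕜] W) (C : ℝ)
    (h : ∀ w, ∃ v, ‖v‖ ≤ C * ‖w‖ ∧ ‖w - T v‖ ≤ 1 / 2 * ‖w‖) : Surjective T := by
  choose g hg hTg using h
  intro w
  have hC : 0 ≤ C * ‖w‖ := (norm_nonneg _).trans (hg w)
  let r : ℕ → W := fun n => (fun w => w - T (g w))^[n] w
  have hr : ∀ n, r (n + 1) = r n - T (g (r n)) := fun n => iterate_succ_apply' _ _ _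
  have hrn : ∀ n, ‖r n‖ ≤ (1 / 2) ^ n * ‖w‖ := by
    intro n
    induction n with
    | zero => simp [r]
    | succ n ih =>
      rw [hr, pow_succ']
      linarith [hTg (r n)]
  have hgeo : Summable fun n : ℕ => (1 / 2 : ℝ) ^ n * ‖w‖ :=
    summable_geometric_two.mul_right _
  have hs : Summable fun n => g (r n) := by
    refine .of_norm_bounded (hgeo.mul_left |C|) fun n => (hg _).trans ?_
    exact mul_le_mul (le_abs_self C) (hrn n) (norm_nonneg _) (abs_nonneg C)
  refine ⟨∑' n, g (r n), ?_⟩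
  have hlim : Filter.Tendsto r Filter.atTop (nhds 0) :=
    squeeze_zero_norm hrn hgeo.tendsto_atTop_zero
  have h1 := (hs.hasSum.mapL T).tendsto_sum_nat
  have h2 : ∀ n, ∑ k ∈ Finset.range n, T (g (r k)) = w - r n := by
    intro n
    induction n with
    | zero => simp [r]
    | succ n ih => rw [Finset.sum_range_succ, ih, hr]; abel
  simp only [h2] at h1
  simpa using tendsto_nhds_unique h1 (hlim.const_sub w)

/-- A `1 / 2`-net of the unit ball suffices to write the space as a quotient of `ℓ₁`. -/
theorem lift_surjective [CompleteSpace W] (t : Γ → W) (ht : ∀ γ, ‖t γ‖ ≤ 1)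
    (h : ∀ w, ‖w‖ ≤ 1 → ∃ γ, ‖w - t γ‖ ≤ 1 / 2) : Surjective (lift (𝕜 := 𝕜) t 1 ht) := by
  refine surjective_of_approx _ 1 fun w => ?_
  rcases eq_or_ne w 0 with rfl | hw
  · exact ⟨0, by simp⟩
  have hw' : (‖w‖ : 𝕜) ≠ 0 := by simpa using hw
  obtain ⟨γ, hγ⟩ := h ((‖w‖ : 𝕜)⁻¹ • w) (norm_smul_inv_norm hw).le
  refine ⟨(‖w‖ : 𝕜) • unitVec 𝕜 γ, by simp [norm_smul], ?_⟩
  rw [map_smul, lift_unitVec]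
  have : w - (‖w‖ : 𝕜) • t γ = (‖w‖ : 𝕜) • ((‖w‖ : 𝕜)⁻¹ • w - t γ) := by
    rw [smul_sub, smul_inv_smul₀ hw']
  rw [this, norm_smul, RCLike.norm_ofReal, abs_norm, mul_comm]
  exact mul_le_mul_of_nonneg_right hγ (norm_nonneg _)

/-- The sums of vectors `c • unitVec 𝕜 γ`, with `c` in a countable dense set of scalars, are dense in
`ℓ₁(Γ)`. They are indexed by finitely supported multiplicities in order to bound their number. -/
theorem exists_denseRange (Γ : Type*) : ∃ g : (Γ × ℕ →₀ ℕ) → LOne 𝕜 Γ, DenseRange g := by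
  let v : Γ × ℕ → LOne 𝕜 Γ := fun a => TopologicalSpace.denseSeq 𝕜 a.2 • unitVec 𝕜 a.1
  let f := Finsupp.linearCombination ℕ v
  refine ⟨f, fun x => ?_⟩
  let M : AddSubmonoid (LOne 𝕜 Γ) := (AddMonoidHom.mrange f.toAddMonoidHom).topologicalClosure
  have hM : ∀ (c : 𝕜) (γ : Γ), c • unitVec 𝕜 γ ∈ M := by
    intro c γ
    have hcont : Continuous fun c : 𝕜 => c • unitVec 𝕜 γ := by fun_prop
    refine map_mem_closure (f := fun c : 𝕜 => c • unitVec 𝕜 γ) hcont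
      (TopologicalSpace.denseRange_denseSeq 𝕜 c) ?_
    rintro _ ⟨n, rfl⟩
    exact ⟨Finsupp.single (γ, n) 1, by simp [f, v]⟩
  have hx : x ∈ M := (AddSubmonoid.isClosed_topologicalClosure _).mem_of_tendsto
    (hasSum_unitVec x) (.of_forall fun E => sum_mem fun γ _ => hM _ _)
  exact hx

/-- If `B` is bounded below, approximate preimages of the points of a dense family in its codomain
form a net in the unit ball of its domain. -/
theorem exists_net_of_antilipschitz {Y D : Type*} [NormedAddCommGroup Y] [NormedSpace 𝕜 Y]
    (B : W →L[𝕜] Y) {δ : ℝ} (hδ : 0 < δ) (hB : ∀ w, δ * ‖w‖ ≤ ‖B w‖) {g : D → Y}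
    (hg : DenseRange g) :
    ∃ t : D → W, (∀ d, ‖t d‖ ≤ 1) ∧ ∀ w, ‖w‖ ≤ 1 → ∃ d, ‖w - t d‖ ≤ 1 / 2 := by
  -- two vectors whose images are within `δ / 4` of the same point are at distance at most `1 / 2`
  have h : ∀ d, ∃ u : W, ‖u‖ ≤ 1 ∧
      ∀ w, ‖w‖ ≤ 1 → ‖B w - g d‖ < δ / 4 → ‖B u - g d‖ < δ / 4 := by
    intro d
    by_cases hd : ∃ w, ‖w‖ ≤ 1 ∧ ‖B w - g d‖ < δ / 4
    · obtain ⟨w, hw, hwd⟩ := hd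
      exact ⟨w, hw, fun _ _ _ => hwd⟩
    · exact ⟨0, by simp, fun w hw hwd => (hd ⟨w, hw, hwd⟩).elim⟩
  choose t ht htd using h
  refine ⟨t, ht, fun w hw => ?_⟩
  obtain ⟨d, hd⟩ := hg.exists_dist_lt (B w) (by positivity : 0 < δ / 4)
  rw [dist_eq_norm] at hd
  refine ⟨d, ?_⟩
  have h1 := htd d w hw hd
  have h2 := hB (w - t d)
  have h3 : ‖B (w - t d)‖ ≤ ‖B w - g d‖ + ‖B (t d) - g d‖ := by
    rw [map_sub, ← sub_sub_sub_cancel_right (B w) (B (t d)) (g d)]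
    exact norm_sub_le _ _
  by_contra! h4
  nlinarith

/-! ### The Eilenberg swindle -/

/-- Since `ℓ₁(I)` is an `ℓ₁`-sum of countably many copies of itself, it absorbs its complemented
subspaces. -/
theorem nonempty_prod_equiv_of_complemented [Infinite I] {Z : Type*} [NormedAddCommGroup Z]
    [NormedSpace 𝕜 Z] (i : Z →L[𝕜] LOne 𝕜 I) (q : LOne 𝕜 I →L[𝕜] Z) (hqi : q ∘L i = .id 𝕜 Z) :
    Nonempty ((LOne 𝕜 I × Z) ≃L[𝕜] LOne 𝕜 I) := by
  obtain ⟨e⟩ : Nonempty (ℕ × I ≃ I) := by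
    rw [← Cardinal.lift_mk_eq']
    simp [Cardinal.aleph0_le_mk]
  let ι : ℕ → LOne 𝕜 I →L[𝕜] LOne 𝕜 (ℕ × I) := fun n => partialMap fun a => some (n, a)
  let π : LOne 𝕜 (ℕ × I) →L[𝕜] LOne 𝕜 I := partialMap fun a => if a.1 = 0 then some a.2 else none
  let σ : LOne 𝕜 (ℕ × I) →L[𝕜] LOne 𝕜 (ℕ × I) := partialMap fun a => some (a.1 + 1, a.2)
  let τ : LOne 𝕜 (ℕ × I) →L[𝕜] LOne 𝕜 (ℕ × I) :=
    partialMap fun a => if a.1 = 0 then none else some (a.1 - 1, a.2)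
  let P : LOne 𝕜 I →L[𝕜] LOne 𝕜 I := i ∘L q
  -- `Q` applies the projection `P = i ∘ q` to each of the copies of `ℓ₁(I)` in `ℓ₁(ℕ × I)`
  let Q : LOne 𝕜 (ℕ × I) →L[𝕜] LOne 𝕜 (ℕ × I) :=
    lift (fun a => ι a.1 (P (unitVec 𝕜 a.2))) ‖P‖ fun a =>
      (norm_partialMap_apply_le _ _).trans ((P.le_opNorm _).trans (by simp))
  have hqi' : ∀ z, q (i z) = z := DFunLike.congr_fun hqi
  have hQι : ∀ n x, Q (ι n x) = ι n (P x) := fun n =>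
    DFunLike.congr_fun (f := Q ∘L ι n) (g := ι n ∘L P) (ext_unitVec fun γ => by simp [Q, ι])
  have hπι : ∀ x, π (ι 0 x) = x :=
    DFunLike.congr_fun (f := π ∘L ι 0) (g := .id 𝕜 _) (ext_unitVec fun γ => by simp [π, ι])
  have hπι' : ∀ n x, π (ι (n + 1) x) = 0 := fun n =>
    DFunLike.congr_fun (f := π ∘L ι (n + 1)) (g := 0) (ext_unitVec fun γ => by simp [π, ι])
  have hσι : ∀ n x, σ (ι n x) = ι (n + 1) x := fun n =>
    DFunLike.congr_fun (f := σ ∘L ι n) (g := ι (n + 1)) (ext_unitVec fun γ => by simp [σ, ι])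
  have hτι : ∀ x, τ (ι 0 x) = 0 :=
    DFunLike.congr_fun (f := τ ∘L ι 0) (g := 0) (ext_unitVec fun γ => by simp [τ, ι])
  have hτι' : ∀ n x, τ (ι (n + 1) x) = ι n x := fun n =>
    DFunLike.congr_fun (f := τ ∘L ι (n + 1)) (g := ι n) (ext_unitVec fun γ => by simp [τ, ι])
  have hvec : ∀ a : ℕ × I, unitVec 𝕜 a = ι a.1 (unitVec 𝕜 a.2) := fun a => by simp [ι]
  have hPP : ∀ x, P (P x) = P x := fun x => by simp [P, hqi']
  have hQQ : ∀ x, Q (Q x) = Q x :=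
    DFunLike.congr_fun (f := Q ∘L Q) (g := Q) (ext_unitVec fun a => by
      simp only [ContinuousLinearMap.comp_apply, hvec, hQι, hPP])
  have hQσ : ∀ x, Q (σ x) = σ (Q x) :=
    DFunLike.congr_fun (f := Q ∘L σ) (g := σ ∘L Q) (ext_unitVec fun a => by
      simp only [ContinuousLinearMap.comp_apply, hvec, hQι, hσι])
  have hQτ : ∀ x, Q (τ x) = τ (Q x) :=
    DFunLike.congr_fun (f := Q ∘L τ) (g := τ ∘L Q) (ext_unitVec fun a => by
      obtain ⟨_ | n, a⟩ := a <;>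
        simp only [ContinuousLinearMap.comp_apply, hvec, hQι, hτι, hτι', map_zero])
  have hπσ : ∀ x, π (σ x) = 0 :=
    DFunLike.congr_fun (f := π ∘L σ) (g := 0) (ext_unitVec fun a => by
      simp only [ContinuousLinearMap.comp_apply, hvec, hσι, hπι', zero_apply])
  have hτσ : ∀ x, τ (σ x) = x :=
    DFunLike.congr_fun (f := τ ∘L σ) (g := .id 𝕜 _) (ext_unitVec fun a => by
      simp only [ContinuousLinearMap.comp_apply, hvec, hσι, hτι', ContinuousLinearMap.id_apply])
  have hστ : ∀ x, ι 0 (π x) + σ (τ x) = x :=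
    DFunLike.congr_fun (f := ι 0 ∘L π + σ ∘L τ) (g := .id 𝕜 _) (ext_unitVec fun a => by
      obtain ⟨_ | n, a⟩ := a <;>
        simp only [ContinuousLinearMap.comp_apply, add_apply, hvec, hσι, hτι',
          hτι, hπι, hπι', map_zero, ContinuousLinearMap.id_apply, zero_add, add_zero])
  have hπQ : ∀ x, π (Q x) = P (π x) :=
    DFunLike.congr_fun (f := π ∘L Q) (g := P ∘L π) (ext_unitVec fun a => by
      obtain ⟨_ | n, a⟩ := a <;>
        simp only [ContinuousLinearMap.comp_apply, hvec, hQι, hπι, hπι', map_zero])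
  have hPi : ∀ z, P (i z) = i z := fun z => by simp [P, hqi']
  have hqP : ∀ x, q (P x) = q x := fun z => by simp [P, hqi']
  -- shift the ranges of the projections by one copy and put `Z` into the gap
  let A : (LOne 𝕜 (ℕ × I) × Z) →L[𝕜] LOne 𝕜 (ℕ × I) :=
    ((σ ∘L Q) + (.id 𝕜 _ - Q)).coprod (ι 0 ∘L i)
  let B : LOne 𝕜 (ℕ × I) →L[𝕜] (LOne 𝕜 (ℕ × I) × Z) := ((τ ∘L Q) + (.id 𝕜 _ - Q)).prod (q ∘L π)
  have hBA : ∀ x, B (A x) = x := by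
    rintro ⟨x, z⟩
    ext1
    · simp [A, B, map_add, map_sub, hQQ, hQσ, hQι, hPi, hτσ, hτι]
    · simp [A, B, map_add, map_sub, hπι, hπσ, hqi', hπQ, hqP]
  have hAB : ∀ y, A (B y) = y := by
    intro y
    have h1 := hστ (Q y)
    rw [hπQ] at h1
    have h2 : i (q (π y)) = P (π y) := rfl
    simp only [A, B, ContinuousLinearMap.coprod_apply, ContinuousLinearMap.prod_apply,
      add_apply, ContinuousLinearMap.comp_apply, sub_apply,
      ContinuousLinearMap.id_apply, map_add, map_sub, hQQ, hQτ, h2]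
    rw [← sub_eq_zero] at h1 ⊢
    rw [← h1]
    abel
  exact ⟨((reindex e.symm).prodCongr (.refl 𝕜 Z)).trans
    ((ContinuousLinearEquiv.equivOfInverse A B hBA hAB).trans (reindex e))⟩

/-! ### Almost disjointly supported families -/

theorem norm_apply_le_of_unitVec [CompleteSpace W] (T : LOne 𝕜 Γ →L[𝕜] W) {C : ℝ}
    (hT : ∀ γ, ‖T (unitVec 𝕜 γ)‖ ≤ C) (x : LOne 𝕜 Γ) : ‖T x‖ ≤ C * ‖x‖ := by
  have h : T = lift (fun γ => T (unitVec 𝕜 γ)) C hT := ext_unitVec fun γ => by simp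
  rw [h]
  exact norm_lift_apply_le _ hT x

/-- The range of `S` contains a vector whose part in `E` has norm one, while the part outside `E`
has norm at most one half. -/
def Concentrated (S : W →L[𝕜] LOne 𝕜 Γ) (E : Finset Γ) : Prop :=
  ∃ w, ‖restr (E : Set Γ) (S w)‖ = 1 ∧ ‖S w - restr (E : Set Γ) (S w)‖ ≤ 1 / 2

/-- Vectors concentrated on disjoint sets span a complemented copy of `ℓ₁`. The functionals norming
their main parts give an operator to `ℓ₁(𝓔)` that is a left inverse up to an error of norm at most
one half. -/
theorem exists_leftInverse_of_concentrated [CompleteSpace W] (S : W →L[𝕜] LOne 𝕜 Γ) {c : ℝ}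
    (hc : 0 < c) (hS : ∀ w, c * ‖w‖ ≤ ‖S w‖) {𝓔 : Set (Finset Γ)} (hd : 𝓔.PairwiseDisjoint id)
    (h𝓔 : ∀ E ∈ 𝓔, Concentrated S E) :
    ∃ (J : LOne 𝕜 𝓔 →L[𝕜] W) (K : W →L[𝕜] LOne 𝕜 𝓔), K ∘L J = .id 𝕜 _ := by
  classical
  choose w hw1 hw2 using fun E : 𝓔 => h𝓔 E E.2
  choose φ hφ1 hφ2 using fun E : 𝓔 => exists_dual_vector'' 𝕜 (restr (E.1 : Set Γ) (S (w E)))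
  have hwn : ∀ E, ‖w E‖ ≤ 3 / 2 / c := by
    intro E
    rw [le_div_iff₀' hc]
    refine (hS _).trans ?_
    have := norm_add_le (S (w E) - restr (E.1 : Set Γ) (S (w E))) (restr (E.1 : Set Γ) (S (w E)))
    rw [sub_add_cancel] at this
    linarith [hw1 E, hw2 E]
  let J : LOne 𝕜 𝓔 →L[𝕜] W := lift w _ hwn
  let t : Γ → LOne 𝕜 𝓔 := fun γ =>
    if h : ∃ E : 𝓔, γ ∈ E.1 then φ h.choose (unitVec 𝕜 γ) • unitVec 𝕜 h.choose else 0
  have ht : ∀ γ, ‖t γ‖ ≤ 1 := by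
    intro γ
    by_cases h : ∃ E : 𝓔, γ ∈ E.1
    · simp only [t, dif_pos h, norm_smul, norm_unitVec, mul_one]
      exact ((φ h.choose).le_opNorm _).trans (by simpa using hφ1 h.choose)
    · simp only [t, dif_neg h, norm_zero, zero_le_one]
  let Φ : LOne 𝕜 Γ →L[𝕜] LOne 𝕜 𝓔 := lift t 1 ht
  have hΦ : ∀ (E : 𝓔) x, Φ (restr (E.1 : Set Γ) x) =
      φ E (restr (E.1 : Set Γ) x) • unitVec 𝕜 E := by
    intro E
    refine DFunLike.congr_fun (f := Φ ∘L restr (E.1 : Set Γ))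
      (g := (φ E).smulRight (unitVec 𝕜 E) ∘L restr (E.1 : Set Γ)) (ext_unitVec fun γ => ?_)
    by_cases hγ : γ ∈ E.1
    · have h : ∃ E : 𝓔, γ ∈ E.1 := ⟨E, hγ⟩
      have hE : h.choose = E :=
        Subtype.ext (hd.elim_finset h.choose.2 E.2 γ h.choose_spec hγ)
      have htγ : t γ = φ E (unitVec 𝕜 γ) • unitVec 𝕜 E := by
        simp only [t, dif_pos h, hE]
      simp [restr_unitVec, hγ, Φ, htγ]
    · simp [restr_unitVec, hγ]
  -- on unit vectors `Φ ∘ S ∘ J` differs from the identity by at most the parts outside the sets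
  have hT : ‖1 - Φ ∘L S ∘L J‖ < 1 := by
    refine (ContinuousLinearMap.opNorm_le_bound _ (by norm_num : (0 : ℝ) ≤ 1 / 2)
      (norm_apply_le_of_unitVec _ fun E => ?_)).trans_lt (by norm_num)
    have h1 : Φ (restr (E.1 : Set Γ) (S (w E))) = unitVec 𝕜 E := by
      rw [hΦ, hφ2, hw1]
      simp
    have h2 : (1 - Φ ∘L S ∘L J) (unitVec 𝕜 E) =
        -Φ (S (w E) - restr (E.1 : Set Γ) (S (w E))) := by
      rw [map_sub, h1]
      simp [J]
    rw [h2, norm_neg]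
    exact (norm_lift_apply_le t ht _).trans (by simpa using hw2 E)
  obtain ⟨v, hv⟩ := isUnit_one_sub_of_norm_lt_one hT
  rw [sub_sub_cancel] at hv
  refine ⟨J, (↑v⁻¹ : LOne 𝕜 𝓔 →L[𝕜] LOne 𝕜 𝓔) ∘L Φ ∘L S, ?_⟩
  exact (congrArg (fun A => (↑v⁻¹ : LOne 𝕜 𝓔 →L[𝕜] LOne 𝕜 𝓔) * A) hv.symm).trans v.inv_mul

/-- For a maximal disjoint family of sets on which vectors in the range of `S` are concentrated, no
such vector can have most of its norm outside the union of the family. -/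
theorem exists_maximal_concentrated (S : W →L[𝕜] LOne 𝕜 Γ) :
    ∃ 𝓔 : Set (Finset Γ), 𝓔.PairwiseDisjoint id ∧ (∀ E ∈ 𝓔, Concentrated S E) ∧
      ∀ w, 1 / 6 * ‖S w‖ ≤ ‖restr (⋃ E ∈ 𝓔, (E : Set Γ)) (S w)‖ := by
  obtain ⟨𝓔, h𝓔⟩ := zorn_subset
    {𝓔 : Set (Finset Γ) | 𝓔.PairwiseDisjoint id ∧ ∀ E ∈ 𝓔, Concentrated S E}
    fun c hcS hc => ⟨⋃₀ c, ⟨(pairwiseDisjoint_sUnion hc.directedOn).2 fun a ha => (hcS ha).1,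
      fun E ⟨a, ha, hE⟩ => (hcS ha).2 E hE⟩, fun a ha => subset_sUnion_of_mem ha⟩
  refine ⟨𝓔, h𝓔.prop.1, h𝓔.prop.2, fun w => ?_⟩
  by_contra! hw
  set A : Set Γ := ⋃ E ∈ 𝓔, (E : Set Γ) with hA
  set x := S w with hx
  have hx0 : 0 < ‖x‖ := by linarith [norm_nonneg (restr A x)]
  classical
  -- cutting off less than `1 / 6` of the norm twice leaves at least `2 / 3` of it on a finite set
  -- disjoint from `A`
  obtain ⟨F, hF⟩ := exists_norm_sub_restr_lt x (by positivity : 0 < 1 / 6 * ‖x‖)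
  let E : Finset Γ := F.filter fun γ => γ ∉ A
  have hEA : (E : Set Γ) = (F : Set Γ) \ A := by
    ext γ
    simp [E]
  have h1 : ‖x - restr (E : Set Γ) x‖ ≤ 1 / 3 * ‖x‖ := by
    have : x - restr (E : Set Γ) x = (x - restr (F : Set Γ) x) + restr (F : Set Γ) (restr A x) := by
      rw [hEA, restr_diff]
      abel
    rw [this]
    refine (norm_add_le _ _).trans ?_
    linarith [norm_restr_apply_le (F : Set Γ) (restr A x)]
  have h2 : 2 / 3 * ‖x‖ ≤ ‖restr (E : Set Γ) x‖ := by
    have := norm_add_le (x - restr (E : Set Γ) x) (restr (E : Set Γ) x)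
    rw [sub_add_cancel] at this
    linarith
  set r := ‖restr (E : Set Γ) x‖ with hr
  have hr0 : 0 < r := by linarith
  have hE : Concentrated S E := by
    refine ⟨((r : 𝕜)⁻¹) • w, ?_, ?_⟩
    · rw [map_smul, map_smul, norm_smul, norm_inv, RCLike.norm_ofReal, abs_of_pos hr0, ← hx, ← hr,
        inv_mul_cancel₀ hr0.ne']
    · rw [map_smul, map_smul, ← smul_sub, norm_smul, norm_inv, RCLike.norm_ofReal, abs_of_pos hr0,
        ← hx, inv_mul_le_iff₀ hr0]
      linarith
  have hdisj : ∀ E' ∈ 𝓔, Disjoint E E' := by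
    intro E' hE'
    refine Finset.disjoint_left.2 fun γ hγ hγ' => ?_
    exact (Finset.mem_filter.1 hγ).2 (mem_biUnion hE' hγ')
  have hmem : E ∈ 𝓔 := by
    refine h𝓔.le_of_ge (y := insert E 𝓔) ⟨?_, ?_⟩ (subset_insert _ _) (mem_insert _ _)
    · exact h𝓔.prop.1.insert fun E' hE' _ => hdisj E' hE'
    · rintro E' (rfl | hE')
      · exact hE
      · exact h𝓔.prop.2 E' hE'
  have hempty : E = ∅ := Finset.disjoint_self_iff_empty _ |>.1 (hdisj E hmem)
  rw [hr, hempty, restr_finset] at hr0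
  simp at hr0

end LOne

/-! ### The alternate lifting property -/

theorem HasALP.exists_section {𝕜 : Type} [RCLike 𝕜] {W X : Type u} [NormedAddCommGroup W]
    [NormedSpace 𝕜 W] [CompleteSpace W] [NormedAddCommGroup X] [NormedSpace 𝕜 X] [CompleteSpace X]
    (h : HasALP 𝕜 W) (ψ : X →L[𝕜] W) (hψ : Function.Surjective ψ) :
    ∃ s : W →L[𝕜] X, ψ ∘L s = .id 𝕜 W := by
  obtain ⟨s, hs⟩ := h X W ψ hψ (.id 𝕜 W)
  exact ⟨s, hs.symm⟩

open LOne

/-- A bounded choice of preimages of the unit vectors, supplied by the open mapping theorem, extends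
to a lifting. -/
theorem hasALP_of_equiv_LOne {𝕜 : Type} [RCLike 𝕜] {Γ : Type*} {W : Type u} [NormedAddCommGroup W]
    [NormedSpace 𝕜 W] [CompleteSpace W] (e : W ≃L[𝕜] LOne 𝕜 Γ) : HasALP 𝕜 W := by
  intro X Y _ _ _ _ _ _ ψ hψ S
  obtain ⟨C, hC, hpre⟩ := ψ.exists_preimage_norm_le hψ
  choose g hg hgn using hpre
  let b : Γ → X := fun γ => g (e.symm (unitVec 𝕜 γ))
  have hb : ∀ γ, ‖b γ‖ ≤ C * ‖(e.symm : LOne 𝕜 Γ →L[𝕜] W)‖ := fun γ =>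
    (hgn _).trans <| mul_le_mul_of_nonneg_left
      (by simpa using (e.symm : LOne 𝕜 Γ →L[𝕜] W).le_opNorm (unitVec 𝕜 γ)) hC.le
  have hlift : ψ ∘L lift b _ hb = (e.symm : LOne 𝕜 Γ →L[𝕜] W) :=
    ext_unitVec fun γ => by simp [b, hg]
  refine ⟨lift b _ hb ∘L e ∘L S, ?_⟩
  ext y
  exact ((DFunLike.congr_fun hlift (e (S y))).trans (by simp)).symm

theorem exists_equiv_LOne_of_finiteDimensional (𝕜 : Type) [RCLike 𝕜] (W : Type u)
    [NormedAddCommGroup W] [NormedSpace 𝕜 W] [FiniteDimensional 𝕜 W] :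
    ∃ Γ : Type u, Nonempty (W ≃L[𝕜] LOne 𝕜 Γ) := by
  let Γ := ULift.{u} (Fin (Module.finrank 𝕜 W))
  have := (equivFun 𝕜 Γ).symm.finiteDimensional
  exact ⟨Γ, ⟨.ofFinrankEq (by simp [(equivFun 𝕜 Γ).finrank_eq, Γ])⟩⟩

/-- A space containing `ℓ₁(I)` as a complemented subspace, and complemented in it, is isomorphic to
it: a complement of `ℓ₁(I)` in the space is absorbed by `ℓ₁(I)`. -/
theorem nonempty_equiv_LOne_of_complemented {𝕜 : Type*} [RCLike 𝕜] {I W : Type*} [Infinite I]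
    [NormedAddCommGroup W] [NormedSpace 𝕜 W]
    (J : LOne 𝕜 I →L[𝕜] W) (K : W →L[𝕜] LOne 𝕜 I) (hKJ : K ∘L J = .id 𝕜 _)
    (s : W →L[𝕜] LOne 𝕜 I) (ψ : LOne 𝕜 I →L[𝕜] W) (hψs : ψ ∘L s = .id 𝕜 _) :
    Nonempty (W ≃L[𝕜] LOne 𝕜 I) := by
  have hKJ' : ∀ x, K (J x) = x := DFunLike.congr_fun hKJ
  have hψs' : ∀ w, ψ (s w) = w := DFunLike.congr_fun hψs
  let Z := LinearMap.ker (K : W →ₗ[𝕜] LOne 𝕜 I)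
  let e : W ≃L[𝕜] LOne 𝕜 I × Z := .equivOfRightInverse K J hKJ'
  let p : W →L[𝕜] Z := .snd 𝕜 _ _ ∘L (e : W →L[𝕜] LOne 𝕜 I × Z)
  have hp : ∀ z : Z, p z = z := fun z => Subtype.ext <| by
    have hz : K z = 0 := z.2
    exact (ContinuousLinearEquiv.snd_equivOfRightInverse K J hKJ' z).trans (by simp [hz])
  obtain ⟨a⟩ := nonempty_prod_equiv_of_complemented (s ∘L Z.subtypeL) (p ∘L ψ)
    (by ext1 z; simp [hψs', hp])
  exact ⟨e.trans a⟩

theorem exists_equiv_LOne_of_hasALP {𝕜 : Type} [RCLike 𝕜] {W : Type u} [NormedAddCommGroup W]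
    [NormedSpace 𝕜 W] [CompleteSpace W] (h : HasALP 𝕜 W) :
    ∃ Γ : Type u, Nonempty (W ≃L[𝕜] LOne 𝕜 Γ) := by
  -- `W` is a quotient of `ℓ₁` of its unit ball, hence isomorphic to a subspace of that space
  let t₀ : Metric.closedBall (0 : W) 1 → W := Subtype.val
  have ht₀ : ∀ d, ‖t₀ d‖ ≤ 1 := fun d => mem_closedBall_zero_iff.1 d.2
  obtain ⟨S, hS⟩ := h.exists_section (lift t₀ 1 ht₀)
    (lift_surjective t₀ ht₀ fun w hw => ⟨⟨w, by simpa using hw⟩, by simp [t₀]⟩)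
  have hSb : ∀ w, 1 * ‖w‖ ≤ ‖S w‖ := fun w => by
    have h1 := norm_lift_apply_le (𝕜 := 𝕜) t₀ ht₀ (S w)
    have h2 : lift t₀ 1 ht₀ (S w) = w := DFunLike.congr_fun hS w
    rw [h2] at h1
    linarith
  obtain ⟨𝓔, hd, h𝓔, hmax⟩ := exists_maximal_concentrated S
  obtain ⟨J, K, hKJ⟩ := exists_leftInverse_of_concentrated S one_pos hSb hd h𝓔
  set A := ⋃ E ∈ 𝓔, (E : Set (Metric.closedBall (0 : W) 1)) with hA
  let B : W →L[𝕜] LOne 𝕜 A := toSubtype A ∘L S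
  have hB : ∀ w, 1 / 6 * ‖w‖ ≤ ‖B w‖ := fun w => by
    have h1 := hmax w
    have h2 := norm_restr_apply_le_norm_toSubtype A (S w)
    have h3 : B w = toSubtype A (S w) := rfl
    rw [h3]
    linarith [hSb w]
  rcases finite_or_infinite 𝓔 with hfin | hinf
  · -- a finite family: `W` embeds into a finite-dimensional space
    have hAfin : A.Finite := Set.Finite.biUnion hfin fun E _ => E.finite_toSet
    have := hAfin.fintype
    have := (equivFun 𝕜 A).symm.finiteDimensional
    have hinj : Function.Injective (B : W →ₗ[𝕜] LOne 𝕜 A) := by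
      refine (injective_iff_map_eq_zero _).2 fun w hw => ?_
      have h1 := hB w
      have h2 : B w = 0 := hw
      rw [h2, norm_zero] at h1
      exact norm_le_zero_iff.1 (by linarith)
    have : FiniteDimensional 𝕜 W := FiniteDimensional.of_injective _ hinj
    exact exists_equiv_LOne_of_finiteDimensional 𝕜 W
  · -- an infinite family: `W` has a net no larger than the family, so it is complemented in `ℓ₁(𝓔)`
    obtain ⟨g, hg⟩ := exists_denseRange (𝕜 := 𝕜) A
    obtain ⟨t, ht, htnet⟩ := exists_net_of_antilipschitz B (by norm_num) hB hg
    obtain ⟨s, hs⟩ := h.exists_section (lift t 1 ht) (lift_surjective t ht htnet)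
    have hcard : Cardinal.mk (A × ℕ →₀ ℕ) ≤ Cardinal.mk 𝓔 := by
      have h0 : Cardinal.aleph0 ≤ Cardinal.mk 𝓔 := Cardinal.aleph0_le_mk _
      have hAcard : Cardinal.mk A ≤ Cardinal.mk 𝓔 := by
        refine (Cardinal.mk_biUnion_le _ _).trans ?_
        refine (mul_le_mul' le_rfl (ciSup_le' fun E => ?_)).trans (Cardinal.mul_aleph0_eq h0).le
        exact (Cardinal.lt_aleph0_of_finite _).le
      have hAN : Cardinal.mk (A × ℕ) ≤ Cardinal.mk 𝓔 := by
        simpa using (mul_le_mul' hAcard le_rfl).trans (Cardinal.mul_aleph0_eq h0).le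
      rcases isEmpty_or_nonempty (A × ℕ) with hempty | hne
      · exact (Cardinal.lt_aleph0_of_finite _).le.trans h0
      · rw [Cardinal.mk_finsupp_nat]
        exact max_le hAN h0
    obtain ⟨f⟩ := hcard
    obtain ⟨i, r, hri⟩ := exists_leftInverse_of_embedding (𝕜 := 𝕜) f
    refine ⟨𝓔, nonempty_equiv_LOne_of_complemented J K hKJ (i ∘L s) (lift t 1 ht ∘L r) ?_⟩
    ext1 w
    have h1 : r (i (s w)) = s w := DFunLike.congr_fun hri (s w)
    exact (congrArg (lift t 1 ht) h1).trans (DFunLike.congr_fun hs w)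

theorem mainTheorem1 {𝕜 : Type} [RCLike 𝕜] (W : Type u) [NormedAddCommGroup W]
    [NormedSpace 𝕜 W] [CompleteSpace W] :
    HasALP 𝕜 W ↔ ∃ Γ : Type u, Nonempty (W ≃L[𝕜] lp (fun _ : Γ => 𝕜) 1) :=
  ⟨exists_equiv_LOne_of_hasALP, fun ⟨_, ⟨e⟩⟩ => hasALP_of_equiv_LOne e⟩
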